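/- **Notation.** Let $w(x)=\frac1{\sqrt{1-x^2}}$, $\langle f,g\rangle=\int_{-1}^1 f(x)g(x)w(x)\,dx$. For measurable $f:[-1,1]\to\mathbb R$ put $\|f\|_p=\left(\int_{-1}^1|f(x)|^pw(x)\,dx\right)^{1/p}$ if $1\le p<\infty$ and $\|f\|_\infty=\sup_{|x|\le1}|f(x)|$, and let $L^p_w=\{f:\|f\|_p<\infty\}$. Let $\mathbb P_N$ be the space of polynomials of degree at most $N$ and $E_N(f)_p=\inf_{P\in\mathbb P_N}\|f-P\|_p$. Let $p_0(x)=\sqrt{1/\pi}$ and $p_r(x)=\sqrt{2/\pi}\,\cos(r\arccos x)$ for $r\ge1$ be the orthonormal Chebyshev polynomials of the first kind, and $x_k^n=\cos\frac{(2k-1)\pi}{2n}$, $k=1,\dots,n$, the Chebyshev zeros. For integers $n\ge1$ and $0\le m<n$ let $\mu_{n,r}^m=1$ if $0\le r\le n-m$, $\mu_{n,r}^m=\frac{m+n-r}{2m}$ if $n-m<r<n+m$, and $\mu_{n,r}^m=0$ otherwise. For $0\le r\le n-m$, $r<n$, let $q_{n,r}^m=p_r$ and $\nu_{n,r}^m=1$;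 for $n-m<r<n$ let $q_{n,r}^m=\mu_{n,r}^mp_r-\mu_{n,2n-r}^mp_{2n-r}$ and $\nu_{n,r}^m=\frac{m^2+(n-r)^2}{2m^2}$. The orthonormal de la Vallée Poussin scaling functions and the associated Fourier projection are $$\tilde\varphi_{n,k}^m=\sum_{r=0}^{n-1}\sqrt{\frac{\pi}{n\,\nu_{n,r}^m}}\;p_r(x_k^n)\,q_{n,r}^m\quad(k=1,\dots,n),\qquad S_n^mf=\sum_{k=1}^n\langle f,\tilde\varphi_{n,k}^m\rangle\,\tilde\varphi_{n,k}^m .$$ **Statement.** Let $0<\theta<1$ be fixed. There is a constant $\mathcal C>0$, depending only on $\theta$, such that for all $1\le p\le\infty$, with $m=\lfloor\theta n\rfloor$: 1. for every $n\ge1$, $S_n^m$ maps $L^p_w$ to $L^p_w$ and $\|S_n^mf\|_p\le\mathcal C\|f\|_p$ for all $f\in L^p_w$; 2. for every $n$ with $m\ge1$ (that is, $n\ge1/\theta$) and every $f\in L^p_w$, $$E_{n+m-1}(f)_p\le\|S_n^mf-f\|_p\le\mathcal C\,E_{n-m}(f)_p .$$ -/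

import Mathlib

open MeasureTheory
open scoped ENNReal NNReal

noncomputable section

namespace VPScaling

/-- The Chebyshev measure `w(x) dx` on `[-1, 1]`, with `w(x) = 1 / √(1 - x ^ 2)`. -/
abbrev chebMeasure : Measure ℝ := Polynomial.Chebyshev.measureT

/-- The scalar product `⟨f, g⟩ = ∫_{-1}^1 f(x) g(x) w(x) dx`. -/
def wInner (f g : ℝ → ℝ) : ℝ := ∫ x, f x * g x ∂chebMeasure

/-- The norm `‖f‖_p`: for `p < ∞` it is `(∫_{-1}^1 |f(x)|^p w(x) dx)^(1/p)`, and for `p = ∞` it is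
the genuine (not essential) supremum of `|f(x)|` over `|x| ≤ 1`. It takes values in `[0, ∞]`. -/
def wNorm (p : ℝ≥0∞) (f : ℝ → ℝ) : ℝ≥0∞ :=
  if p = ∞ then ⨆ x ∈ Set.Icc (-1 : ℝ) 1, ‖f x‖ₑ else eLpNorm f p chebMeasure

/-- The space `L^p_w`: measurable functions on `[-1, 1]` with `‖f‖_p < ∞`. Functions on `[-1, 1]` are
represented by functions on `ℝ` whose values outside `[-1, 1]` play no role. -/
def MemLpw (p : ℝ≥0∞) (f : ℝ → ℝ) : Prop :=
  AEStronglyMeasurable f chebMeasure ∧ wNorm p f < ∞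

/-- The error `E_N(f)_p` of best approximation by polynomials of degree at most `N`. -/
def bestError (N : ℕ) (f : ℝ → ℝ) (p : ℝ≥0∞) : ℝ≥0∞ :=
  ⨅ P ∈ Polynomial.degreeLE ℝ (N : WithBot ℕ), wNorm p (fun x => f x - P.eval x)

/-- The orthonormal Chebyshev polynomial `p_r` of the first kind and degree `r`. On `[-1, 1]`,
`T_r(x) = cos (r arccos x)`. -/
def chebP (r : ℕ) (x : ℝ) : ℝ :=
  (if r = 0 then √(1 / Real.pi) else √(2 / Real.pi)) *
    (Polynomial.Chebyshev.T ℝ (r : ℤ)).eval x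

/-- The Chebyshev zeros `x_k^n = cos ((2k - 1) π / (2n))`, `k = 1, …, n`. -/
def chebNode (n k : ℕ) : ℝ := Real.cos ((2 * (k : ℝ) - 1) * Real.pi / (2 * (n : ℝ)))

/-- The de la Vallée Poussin coefficients `μ_{n,r}^m`. -/
def mu (n m r : ℕ) : ℝ :=
  if r + m ≤ n then 1
  else if r < n + m then ((m : ℝ) + (n : ℝ) - (r : ℝ)) / (2 * (m : ℝ))
  else 0

/-- The numbers `ν_{n,r}^m`, for `r < n`. -/
def nu (n m r : ℕ) : ℝ :=
  if r + m ≤ n then 1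
  else ((m : ℝ) ^ 2 + ((n : ℝ) - (r : ℝ)) ^ 2) / (2 * (m : ℝ) ^ 2)

/-- The orthogonal polynomials `q_{n,r}^m`, for `r < n`. -/
def q (n m r : ℕ) (x : ℝ) : ℝ :=
  if r + m ≤ n then chebP r x
  else mu n m r * chebP r x - mu n m (2 * n - r) * chebP (2 * n - r) x

/-- The coefficients `τ_{r,k}^n = √(π / (n ν_{n,r}^m)) p_r(x_k^n)`. -/
def tau (n m r k : ℕ) : ℝ := √(Real.pi / ((n : ℝ) * nu n m r)) * chebP r (chebNode n k)

/-- The orthonormal VP scaling functions, for `k = 1, …, n`. -/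
def scaling (n m k : ℕ) (x : ℝ) : ℝ := ∑ r ∈ Finset.range n, tau n m r k * q n m r x

/-- The Fourier projection `S_n^m f = ∑_{k=1}^n ⟨f, φ_k⟩ φ_k` on the orthonormal VP scaling
functions `φ_k`. -/
def S (n m : ℕ) (f : ℝ → ℝ) (x : ℝ) : ℝ :=
  ∑ k ∈ Finset.Icc 1 n, wInner f (scaling n m k) * scaling n m k x

end VPScaling

end

/-! `S n m` is an integral operator with symmetric kernel $K(x,y)=\sum_k\varphi_k(x)\varphi_k(y)$.
Both claims follow from a bound on $\int|K(x,y)|w(y)\,dy$ that is uniform in $n$ and in every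
$x\in[-1,1]$. The Schur test then gives boundedness for $p<\infty$ and a direct estimate gives it
for the genuine supremum (`wNorm_S_le`). The error estimate follows since `S n m` reproduces
polynomials of degree at most $n-m$ (`S_polynomial`) and takes values in those of degree at most
$n+m-1$ (`exists_polynomial_S_eq`).

For the kernel bound, discrete orthogonality at the Chebyshev zeros gives
$K=\sum_r\nu_r^{-1}q_r(x)q_r(y)$ (`kernel_eq_sum`). With $x=\cos s$, $y=\cos t$, the squares in
$q_rq_r$ produce a cosine sum in $s\pm t$, while the mixed products produce another one modulated by
factors $\cos(n(s\mp t))$, which are at most 1 in absolute value (`pi_mul_kernel_cos`). The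
coefficients of both are 1-Lipschitz functions of the clamped ratio $(n-j)/m$ or $d/m$, so
consecutive ones differ by at most $1/m$.

A cosine sum of length $N$ with coefficients bounded by 1 and increments at most $\delta$ has $L^1$
norm bounded in terms of $N\delta$ alone (`integral_abs_cosSum_le`). Here $N\delta\le 2n/m\le
4/\theta$ once $m\ge1$. If $m=0$ then $n<1/\theta$, and a crude bound is enough. -/

namespace VPScaling

open Real Finset

/-! ### $L^1$ bounds for cosine sums. -/

/-- The cosine sum `a₀ + 2 ∑_{1 ≤ j ≤ N} a_j cos (j u)`. -/
noncomputable def cosSum (a : ℕ → ℝ) (N : ℕ) (u : ℝ) : ℝ :=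
  2 * ∑ j ∈ range (N + 1), a j * cos (j * u) - a 0

lemma continuous_cosSum (a : ℕ → ℝ) (N : ℕ) : Continuous (cosSum a N) := by
  unfold cosSum; fun_prop

lemma periodic_cosSum (a : ℕ → ℝ) (N : ℕ) : Function.Periodic (cosSum a N) (2 * π) := by
  intro u
  simp only [cosSum, mul_add, cos_add_nat_mul_two_pi]

lemma integral_cos_int_mul {k : ℤ} (hk : k ≠ 0) : ∫ u in -π..π, cos (k * u) = 0 := by
  have hk' : (k : ℝ) ≠ 0 := Int.cast_ne_zero.mpr hk
  rw [intervalIntegral.integral_comp_mul_left _ hk', integral_cos, mul_neg, sin_neg,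
    sin_int_mul_pi]
  simp

lemma integral_sum_sq_of_orthogonal {e : ℕ → ℝ → ℝ} (he : ∀ j, Continuous (e j)) {c : ℕ → ℝ}
    (h : ∀ i j, ∫ u in -π..π, e i u * e j u = if i = j then c i else 0) (b : ℕ → ℝ) (N : ℕ) :
    ∫ u in -π..π, (∑ j ∈ range N, b j * e j u) ^ 2 = ∑ j ∈ range N, b j ^ 2 * c j := by
  have h1 : ∀ u, (∑ j ∈ range N, b j * e j u) ^ 2 =
      ∑ i ∈ range N, ∑ j ∈ range N, b i * b j * (e i u * e j u) := by
    intro u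
    rw [sq, sum_mul_sum]
    exact sum_congr rfl fun i _ => sum_congr rfl fun j _ => by ring
  simp_rw [h1]
  rw [intervalIntegral.integral_finsetSum
    fun i _ => Continuous.intervalIntegrable (by fun_prop) _ _]
  refine sum_congr rfl fun i hi => ?_
  rw [intervalIntegral.integral_finsetSum
    fun j _ => Continuous.intervalIntegrable (by fun_prop) _ _]
  simp_rw [intervalIntegral.integral_const_mul, h]
  simp only [mul_ite, mul_zero, sum_ite_eq, hi, if_true]
  ring

lemma integral_cos_mul_cos (i j : ℕ) :
    ∫ u in -π..π, cos (i * u) * cos (j * u) =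
      if i = j then (if i = 0 then 2 * π else π) else 0 := by
  have h1 : ∀ u : ℝ, cos (i * u) * cos (j * u) =
      (cos (((i - j : ℤ) : ℝ) * u) + cos (((i + j : ℤ) : ℝ) * u)) / 2 := by
    intro u
    push_cast
    rw [sub_mul, add_mul, cos_sub, cos_add]; ring
  simp_rw [h1]
  rw [intervalIntegral.integral_div, intervalIntegral.integral_add
    (Continuous.intervalIntegrable (by fun_prop) _ _)
    (Continuous.intervalIntegrable (by fun_prop) _ _)]
  split_ifs with hij hi
  · subst hij; subst hi; simp; ring
  · subst hij
    rw [integral_cos_int_mul (k := (i + i : ℤ)) (by omega)]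
    simp
  · rw [integral_cos_int_mul (by omega), integral_cos_int_mul (by omega)]
    simp

lemma integral_sin_mul_sin_half (i j : ℕ) :
    ∫ u in -π..π, sin ((i + 1 / 2) * u) * sin ((j + 1 / 2) * u) =
      if i = j then π else 0 := by
  have h1 : ∀ u : ℝ, sin ((i + 1 / 2) * u) * sin ((j + 1 / 2) * u) =
      (cos (((i - j : ℤ) : ℝ) * u) - cos (((i + j + 1 : ℤ) : ℝ) * u)) / 2 := by
    intro u
    push_cast
    rw [show ((i : ℝ) - j) * u = (i + 1 / 2) * u - (j + 1 / 2) * u by ring,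
      show ((i : ℝ) + j + 1) * u = (i + 1 / 2) * u + (j + 1 / 2) * u by ring, cos_sub, cos_add]
    ring
  simp_rw [h1]
  rw [intervalIntegral.integral_div, intervalIntegral.integral_sub
    (Continuous.intervalIntegrable (by fun_prop) _ _)
    (Continuous.intervalIntegrable (by fun_prop) _ _),
    integral_cos_int_mul (k := (i + j + 1 : ℤ)) (by omega)]
  split_ifs with hij
  · subst hij; simp
  · rw [integral_cos_int_mul (by omega)]
    simp

lemma integral_cosSum_sq_le {a : ℕ → ℝ} (ha : ∀ j, |a j| ≤ 1) (N : ℕ) :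
    ∫ u in -π..π, cosSum a N u ^ 2 ≤ (N + 1) * (4 * π) := by
  have h1 : ∀ u, cosSum a N u =
      ∑ j ∈ range (N + 1), (if j = 0 then a 0 else 2 * a j) * cos (j * u) := by
    intro u
    rw [cosSum, sum_range_succ', sum_range_succ', mul_add, mul_sum]
    simp only [Nat.add_eq_zero_iff, one_ne_zero, and_false, if_false, if_true, mul_assoc]
    simp; ring
  simp_rw [h1]
  rw [integral_sum_sq_of_orthogonal (fun j => by fun_prop) integral_cos_mul_cos]
  calc _ ≤ ∑ j ∈ range (N + 1), 4 * π := by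
        refine sum_le_sum fun j _ => ?_
        have h2 : a j ^ 2 ≤ 1 := by
          rw [← sq_abs]; exact pow_le_one₀ (abs_nonneg _) (ha j)
        have := pi_pos
        split_ifs with hj
        · subst hj; nlinarith
        · nlinarith
    _ = _ := by simp

/-- Summation by parts: multiplying by $2\sin(u/2)$ turns the coefficients into their differences,
and the sines of half-integer frequency are again orthogonal. -/
lemma two_sin_half_mul_cosSum {a : ℕ → ℝ} {N : ℕ} (hN : a (N + 1) = 0) (u : ℝ) :
    2 * sin (u / 2) * cosSum a N u =
      ∑ j ∈ range (N + 1), 2 * (a j - a (j + 1)) * sin ((j + 1 / 2) * u) := by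
  -- The induction must carry the boundary term, which vanishes only at $M=N$.
  have key : ∀ M : ℕ, 2 * sin (u / 2) * cosSum a M u =
      ∑ j ∈ range (M + 1), 2 * (a j - a (j + 1)) * sin ((j + 1 / 2) * u) +
        2 * a (M + 1) * sin ((M + 1 / 2) * u) := by
    intro M
    induction M with
    | zero => simp [cosSum]; ring_nf
    | succ M ih =>
      have h1 : cosSum a (M + 1) u = cosSum a M u + 2 * a (M + 1) * cos ((M + 1) * u) := by
        simp only [cosSum]
        rw [sum_range_succ _ (M + 1)]
        push_cast; ring
      rw [h1, mul_add, ih, sum_range_succ _ (M + 1)]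
      have h2 : 2 * sin (u / 2) * cos ((M + 1) * u) =
          sin ((M + 1 + 1 / 2) * u) - sin ((M + 1 / 2) * u) := by
        rw [show ((M : ℝ) + 1 + 1 / 2) * u = (M + 1) * u + u / 2 by ring,
          show ((M : ℝ) + 1 / 2) * u = (M + 1) * u - u / 2 by ring, sin_add, sin_sub]
        ring
      push_cast
      linear_combination 2 * a (M + 1) * h2
  rw [key N, hN]; simp

lemma integral_sin_half_mul_cosSum_sq_le {a : ℕ → ℝ} {N : ℕ} {δ : ℝ} (hN : a (N + 1) = 0)
    (hδ : ∀ j, |a j - a (j + 1)| ≤ δ) :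
    ∫ u in -π..π, (2 * sin (u / 2) * cosSum a N u) ^ 2 ≤ (N + 1) * (4 * δ ^ 2 * π) := by
  simp_rw [two_sin_half_mul_cosSum hN]
  rw [integral_sum_sq_of_orthogonal (fun j => by fun_prop) integral_sin_mul_sin_half]
  calc _ ≤ ∑ j ∈ range (N + 1), 4 * δ ^ 2 * π := by
        refine sum_le_sum fun j _ => ?_
        have h2 : (a j - a (j + 1)) ^ 2 ≤ δ ^ 2 := by
          rw [← sq_abs]; exact pow_le_pow_left₀ (abs_nonneg _) (hδ j) 2
        have := pi_pos
        nlinarith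
    _ = _ := by simp

lemma sq_mul_two_div_pi_le_sin_half_sq {u : ℝ} (hu : u ∈ Set.Icc (-π) π) :
    (2 / π * u) ^ 2 ≤ (2 * sin (u / 2)) ^ 2 := by
  wlog h : 0 ≤ u generalizing u
  · have := this (u := -u) ⟨by linarith [hu.2], by linarith [hu.1]⟩ (by linarith)
    rw [neg_div, sin_neg] at this
    simpa using this
  have h1 := mul_le_sin (x := u / 2) (by linarith) (by linarith [hu.2])
  have := pi_pos
  refine pow_le_pow_left₀ (by positivity) ?_ 2
  linarith

lemma integral_div_one_add_sq_le {N : ℕ} (hN : 0 < N) :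
    ∫ u in -π..π, N / (1 + (N * (2 / π * u)) ^ 2) ≤ π ^ 2 / 2 := by
  have hpi := pi_pos
  have hN' : (0 : ℝ) < N := by exact_mod_cast hN
  have h1 : ∀ u : ℝ, N / (1 + (N * (2 / π * u)) ^ 2) =
      N * (fun v => (1 + v ^ 2)⁻¹) ((N * (2 / π)) * u) := by
    intro u; simp only [div_eq_mul_inv]; ring_nf
  rw [intervalIntegral.integral_congr fun u _ => h1 u, intervalIntegral.integral_const_mul,
    intervalIntegral.integral_comp_mul_left (fun v => (1 + v ^ 2)⁻¹) (by positivity), integral_inv_one_add_sq, smul_eq_mul]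
  have h2 := arctan_lt_pi_div_two (N * (2 / π) * π)
  have h3 := neg_pi_div_two_lt_arctan (N * (2 / π) * -π)
  calc _ ≤ N * ((N * (2 / π))⁻¹ * π) := by gcongr; linarith
    _ = _ := by field_simp

/-- AM-GM for $t^2D/A$ and $A/D$ with $D=1+(As)^2$. It is a pointwise Cauchy–Schwarz inequality,
used with $A=N$ and $s=2\sin(u/2)$: the first two terms are controlled by Parseval, and the weight
$A/D$ has integral bounded independently of $N$. -/
lemma abs_le_weighted {A t s : ℝ} (hA : 0 < A) :
    |t| ≤ (A⁻¹ * t ^ 2 + A * (s * t) ^ 2 + A / (1 + (A * s) ^ 2)) / 2 := by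
  have hD : 0 < 1 + (A * s) ^ 2 := by positivity
  set D := 1 + (A * s) ^ 2 with hDdef
  have h : A⁻¹ * t ^ 2 + A * (s * t) ^ 2 + A / D - 2 * |t| = (D * |t| - A) ^ 2 / (A * D) := by
    rw [hDdef]
    field_simp
    have h0 := sq_abs t
    ring_nf
    simp only [h0]
    ring
  have : 0 ≤ (D * |t| - A) ^ 2 / (A * D) := by positivity
  linarith

/-- The `L¹` norm of a cosine sum of length `N` is bounded in terms of `N` times the largest
difference of consecutive coefficients. -/
theorem integral_abs_cosSum_le {a : ℕ → ℝ} {N : ℕ} {δ : ℝ} (hN0 : 0 < N) (hN : a (N + 1) = 0)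
    (ha : ∀ j, |a j| ≤ 1) (hδ : ∀ j, |a j - a (j + 1)| ≤ δ) :
    ∫ u in -π..π, |cosSum a N u| ≤ 4 * π + 4 * π * (N * δ) ^ 2 + π ^ 2 / 4 := by
  have hpi := pi_pos
  have hN' : (0 : ℝ) < N := by exact_mod_cast hN0
  have hN1 : (1 : ℝ) ≤ N := by exact_mod_cast hN0
  have hc := continuous_cosSum a N
  have hD : ∀ u : ℝ, 1 + (N * (2 / π * u)) ^ 2 ≠ 0 := fun u => by positivity
  have hi1 : IntervalIntegrable (fun u => (N : ℝ)⁻¹ * cosSum a N u ^ 2) volume (-π) π :=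
    Continuous.intervalIntegrable (by fun_prop) _ _
  have hi2 : IntervalIntegrable (fun u => N * (2 * sin (u / 2) * cosSum a N u) ^ 2)
    volume (-π) π := Continuous.intervalIntegrable (by fun_prop) _ _
  have hi3 : IntervalIntegrable (fun u => N / (1 + (N * (2 / π * u)) ^ 2)) volume (-π) π :=
    Continuous.intervalIntegrable (by fun_prop (disch := exact hD _)) _ _
  calc ∫ u in -π..π, |cosSum a N u|
      ≤ ∫ u in -π..π, ((N : ℝ)⁻¹ * cosSum a N u ^ 2 + N * (2 * sin (u / 2) * cosSum a N u) ^ 2 +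
          N / (1 + (N * (2 / π * u)) ^ 2)) / 2 := by
        refine intervalIntegral.integral_mono_on (by linarith) (hc.abs.intervalIntegrable _ _)
          (((hi1.add hi2).add hi3).div_const _) fun u hu => ?_
        refine (abs_le_weighted (s := 2 * sin (u / 2)) hN').trans ?_
        -- Jordan's inequality replaces the sine by a linear function in the denominator only,
        -- making that term an explicit arctangent integral.
        have h1 := sq_mul_two_div_pi_le_sin_half_sq hu
        rw [mul_pow (N : ℝ) (2 / π * u), mul_pow (N : ℝ) (2 * sin (u / 2))]
        gcongr
    _ = ((N : ℝ)⁻¹ * (∫ u in -π..π, cosSum a N u ^ 2) +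
          N * (∫ u in -π..π, (2 * sin (u / 2) * cosSum a N u) ^ 2) +
          ∫ u in -π..π, N / (1 + (N * (2 / π * u)) ^ 2)) / 2 := by
        rw [intervalIntegral.integral_div, intervalIntegral.integral_add (hi1.add hi2) hi3,
          intervalIntegral.integral_add hi1 hi2, intervalIntegral.integral_const_mul,
          intervalIntegral.integral_const_mul]
    _ ≤ ((N : ℝ)⁻¹ * ((2 * N) * (4 * π)) + N * ((2 * N) * (4 * δ ^ 2 * π)) + π ^ 2 / 2) / 2 := by
        have h2 : (N : ℝ) + 1 ≤ 2 * N := by linarith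
        have e1 := (integral_cosSum_sq_le ha N).trans
          (mul_le_mul_of_nonneg_right h2 (by positivity))
        have e2 := (integral_sin_half_mul_cosSum_sq_le hN hδ).trans
          (mul_le_mul_of_nonneg_right h2 (by positivity))
        have e3 := integral_div_one_add_sq_le hN0
        gcongr
    _ = _ := by field_simp; ring

/-- Integrating over `t ∈ [0, π]` the two shifts `s - t` and `s + t` of a `2π`-periodic function
covers a full period. -/
lemma integral_comp_sub_add_comp_add {g : ℝ → ℝ} (hg : Continuous g)
    (hp : Function.Periodic g (2 * π)) (s : ℝ) :
    (∫ t in 0..π, g (s - t)) + ∫ t in 0..π, g (s + t) = ∫ u in -π..π, g u := by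
  rw [intervalIntegral.integral_comp_sub_left, intervalIntegral.integral_comp_add_left,
    sub_zero, add_zero, intervalIntegral.integral_add_adjacent_intervals
      (hg.intervalIntegrable _ _) (hg.intervalIntegrable _ _)]
  have := hp.intervalIntegral_add_eq (s - π) (-π)
  rwa [show s - π + 2 * π = s + π by ring, show -π + 2 * π = π by ring] at this

/-! ### Orthogonality and the kernel of the projection. -/

/-- The orthonormal Chebyshev polynomial `p_r`, as a polynomial. -/
noncomputable def chebPoly (r : ℕ) : Polynomial ℝ :=
  Polynomial.C (if r = 0 then √(1 / π) else √(2 / π)) * Polynomial.Chebyshev.T ℝ (r : ℤ)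

lemma chebP_eq_eval (r : ℕ) (x : ℝ) : chebP r x = (chebPoly r).eval x := by
  simp [chebP, chebPoly]

lemma continuous_chebP (r : ℕ) : Continuous (chebP r) := by
  unfold chebP; fun_prop

lemma continuous_q (n m r : ℕ) : Continuous (q n m r) := by
  have := continuous_chebP
  unfold q
  split_ifs <;> fun_prop

lemma continuous_scaling (n m k : ℕ) : Continuous (scaling n m k) := by
  have := continuous_q
  unfold scaling
  fun_prop

lemma degree_chebPoly_le (r : ℕ) : (chebPoly r).degree ≤ r := by
  refine Polynomial.degree_le_of_natDegree_le ((Polynomial.natDegree_C_mul_le _ _).trans ?_)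
  rw [Polynomial.Chebyshev.natDegree_T, Int.natAbs_natCast]

lemma chebP_cos (r : ℕ) (t : ℝ) :
    chebP r (cos t) = (if r = 0 then √(1 / π) else √(2 / π)) * cos (r * t) := by
  rw [chebP, Polynomial.Chebyshev.T_real_cos]; simp

/-- The Chebyshev polynomials `p_r` are orthonormal. -/
lemma integral_chebP_mul_chebP (r s : ℕ) :
    ∫ x, chebP r x * chebP s x ∂chebMeasure = if r = s then 1 else 0 := by
  have hpi := pi_pos
  have h1 : ∀ x, chebP r x * chebP s x =
      ((if r = 0 then √(1 / π) else √(2 / π)) * (if s = 0 then √(1 / π) else √(2 / π))) *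
      ((Polynomial.Chebyshev.T ℝ (r : ℤ)).eval x * (Polynomial.Chebyshev.T ℝ (s : ℤ)).eval x) := by
    intro x; simp only [chebP]; ring
  simp_rw [h1]
  rw [integral_const_mul]
  split_ifs with hr hs hrs hrs hs hrs hrs <;> try omega
  · subst hr; subst hs
    rw [Nat.cast_zero, Polynomial.Chebyshev.integral_eval_T_real_mul_self_measureT_zero,
      mul_self_sqrt (by positivity)]
    field_simp
  · rw [Polynomial.Chebyshev.integral_eval_T_real_mul_eval_T_real_measureT_of_ne (by omega)]
    simp
  · rw [Polynomial.Chebyshev.integral_eval_T_real_mul_eval_T_real_measureT_of_ne (by omega)]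
    simp
  · subst hrs
    rw [Polynomial.Chebyshev.integral_T_real_mul_self_measureT_of_ne_zero hr,
      mul_self_sqrt (by positivity)]
    field_simp
  · rw [Polynomial.Chebyshev.integral_eval_T_real_mul_eval_T_real_measureT_of_ne hrs]
    simp

/-- Discrete orthogonality at the Chebyshev zeros. -/
lemma sum_chebP_chebNode {n r s : ℕ} (hr : r < n) (hs : s < n) :
    ∑ k ∈ Icc 1 n, chebP r (chebNode n k) * chebP s (chebNode n k) =
      if r = s then n / π else 0 := by
  have hn : n ≠ 0 := by omega
  have hn' : (n : ℝ) ≠ 0 := by exact_mod_cast hn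
  have hdeg : (chebPoly r * chebPoly s).degree < 2 * n := by
    refine (Polynomial.degree_mul_le _ _).trans_lt
      ((add_le_add (degree_chebPoly_le r) (degree_chebPoly_le s)).trans_lt ?_)
    exact_mod_cast (by omega : r + s < 2 * n)
  -- Gauss–Chebyshev quadrature with $n$ nodes is exact below degree $2n$, so discrete orthogonality
  -- is inherited from the continuous one.
  have h1 := Polynomial.Chebyshev.integral_eq_sumZeroes hn hdeg
  simp only [Polynomial.eval_mul, ← chebP_eq_eval] at h1
  rw [integral_chebP_mul_chebP, Polynomial.Chebyshev.sumZeroes] at h1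
  have h2 : ∑ k ∈ Icc 1 n, chebP r (chebNode n k) * chebP s (chebNode n k) =
      ∑ i ∈ range n, (chebPoly r * chebPoly s).eval (cos ((2 * i + 1) / (2 * n) * π)) := by
    refine sum_nbij' (· - 1) (· + 1) ?_ ?_ ?_ ?_ ?_
    · intro k hk; simp at hk ⊢; omega
    · intro k hk; simp at hk ⊢; omega
    · intro k hk; simp at hk ⊢; omega
    · intro k hk; simp
    · intro k hk
      obtain ⟨i, rfl⟩ : ∃ i, k = i + 1 := ⟨k - 1, by simp at hk; omega⟩
      rw [Polynomial.eval_mul, ← chebP_eq_eval, ← chebP_eq_eval]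
      have : chebNode n (i + 1) = cos ((2 * (i : ℝ) + 1) / (2 * n) * π) := by
        rw [chebNode]; push_cast; congr 1; ring
      rw [this]; simp
  rw [h2, ← mul_right_inj' (show π / n ≠ 0 by positivity), ← h1]
  have := pi_pos
  split_ifs
  · field_simp
  · simp

/-- The kernel of the projection `S n m`. -/
noncomputable def kernel (n m : ℕ) (x y : ℝ) : ℝ :=
  ∑ k ∈ Icc 1 n, scaling n m k x * scaling n m k y

lemma continuous_kernel (n m : ℕ) : Continuous fun z : ℝ × ℝ => kernel n m z.1 z.2 := by
  have := continuous_scaling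
  unfold kernel
  fun_prop

lemma kernel_comm (n m : ℕ) (x y : ℝ) : kernel n m x y = kernel n m y x := by
  simp only [kernel, mul_comm]

lemma nu_pos {n m r : ℕ} (hr : r < n) : 0 < nu n m r := by
  unfold nu
  split_ifs with h
  · exact one_pos
  · have : (0 : ℝ) < m := by exact_mod_cast (by omega : 0 < m)
    positivity

/-- Summing over the nodes first, discrete orthogonality gives
$\sum_k\tau_{r,k}\tau_{s,k}=\delta_{rs}/\nu_r$. -/
lemma kernel_eq_sum (n m : ℕ) (x y : ℝ) :
    kernel n m x y = ∑ r ∈ range n, (nu n m r)⁻¹ * (q n m r x * q n m r y) := by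
  have hpi := pi_pos
  have h1 : ∀ k, scaling n m k x * scaling n m k y =
      ∑ r ∈ range n, ∑ s ∈ range n, √(π / (n * nu n m r)) * √(π / (n * nu n m s)) *
        (q n m r x * q n m s y) * (chebP r (chebNode n k) * chebP s (chebNode n k)) := by
    intro k
    rw [scaling, scaling, sum_mul_sum]
    refine sum_congr rfl fun r _ => sum_congr rfl fun s _ => ?_
    rw [tau, tau]; ring
  unfold kernel
  simp_rw [h1]
  rw [sum_comm]
  refine sum_congr rfl fun r hr => ?_
  rw [sum_comm]
  have hr' := mem_range.1 hr
  have hn : (0 : ℝ) < n := by exact_mod_cast (by omega : 0 < n)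
  have hν := nu_pos (m := m) hr'
  calc _ = ∑ s ∈ range n, √(π / (n * nu n m r)) * √(π / (n * nu n m s)) *
        (q n m r x * q n m s y) * (if r = s then n / π else 0) := by
        refine sum_congr rfl fun s hs => ?_
        rw [← mul_sum, sum_chebP_chebNode hr' (mem_range.1 hs)]
    _ = _ := by
        simp only [mul_ite, mul_zero, sum_ite_eq, hr, if_true]
        rw [mul_self_sqrt (by positivity)]
        field_simp

/-! ### Size and increments of the kernel coefficients. -/

/-- Clamping to `[-1, 1]`. -/
noncomputable def clamp (t : ℝ) : ℝ := max (-1) (min 1 t)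

lemma clamp_of_mem {t : ℝ} (h1 : -1 ≤ t) (h2 : t ≤ 1) : clamp t = t := by
  rw [clamp, min_eq_right h2, max_eq_right h1]

lemma clamp_of_one_le {t : ℝ} (h : 1 ≤ t) : clamp t = 1 := by
  rw [clamp, min_eq_left h, max_eq_right (by norm_num)]

lemma clamp_of_le_neg_one {t : ℝ} (h : t ≤ -1) : clamp t = -1 := by
  rw [clamp, min_eq_right (by linarith), max_eq_left h]

lemma abs_clamp_sub_clamp_le (s t : ℝ) : |clamp s - clamp t| ≤ |s - t| := by
  unfold clamp
  rw [max_comm (-1), max_comm (-1)]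
  exact (abs_max_sub_max_le_abs _ _ _).trans (by
    simpa using abs_min_sub_min_le_max 1 s 1 t)

/-- The Fourier coefficients of the diagonal part of the kernel. -/
noncomputable def diagCoeff (n m j : ℕ) : ℝ :=
  1 / 2 + clamp (((n : ℝ) - j) / m) / (1 + clamp (((n : ℝ) - j) / m) ^ 2)

/-- The Fourier coefficients of the off-diagonal part of the kernel. -/
noncomputable def crossCoeff (m d : ℕ) : ℝ := 1 / (1 + clamp ((d : ℝ) / m) ^ 2) - 1 / 2

lemma abs_div_one_add_sq_sub_le (s t : ℝ) :
    |s / (1 + s ^ 2) - t / (1 + t ^ 2)| ≤ |s - t| := by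
  have hs : 0 < 1 + s ^ 2 := by positivity
  have ht : 0 < 1 + t ^ 2 := by positivity
  have h : s / (1 + s ^ 2) - t / (1 + t ^ 2) =
      (s - t) * ((1 - s * t) / ((1 + s ^ 2) * (1 + t ^ 2))) := by field_simp; ring
  rw [h, abs_mul]
  refine mul_le_of_le_one_right (abs_nonneg _) ?_
  rw [abs_div, abs_of_pos (mul_pos hs ht), div_le_one (mul_pos hs ht), abs_le]
  constructor <;> nlinarith [sq_nonneg (s * t), sq_nonneg (s - t), sq_nonneg (s + t)]

lemma abs_one_div_one_add_sq_sub_le (s t : ℝ) :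
    |1 / (1 + s ^ 2) - 1 / (1 + t ^ 2)| ≤ |s - t| := by
  have hs : 0 < 1 + s ^ 2 := by positivity
  have ht : 0 < 1 + t ^ 2 := by positivity
  have h : 1 / (1 + s ^ 2) - 1 / (1 + t ^ 2) =
      (s - t) * (-(s + t) / ((1 + s ^ 2) * (1 + t ^ 2))) := by field_simp; ring
  rw [h, abs_mul]
  refine mul_le_of_le_one_right (abs_nonneg _) ?_
  rw [abs_div, abs_of_pos (mul_pos hs ht), div_le_one (mul_pos hs ht), abs_le]
  constructor <;>
    nlinarith [sq_nonneg (s * t), sq_nonneg (s - 1), sq_nonneg (s + 1), sq_nonneg (t - 1),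
      sq_nonneg (t + 1)]

lemma abs_diagCoeff_le (n m j : ℕ) : |diagCoeff n m j| ≤ 1 := by
  unfold diagCoeff
  generalize clamp _ = c
  have hc : 0 < 1 + c ^ 2 := by positivity
  have h1 : c / (1 + c ^ 2) ≤ 1 / 2 := by
    rw [div_le_div_iff₀ hc two_pos]; nlinarith [sq_nonneg (c - 1)]
  have h2 : -(1 / 2) ≤ c / (1 + c ^ 2) := by
    rw [le_div_iff₀ hc]; nlinarith [sq_nonneg (c + 1)]
  rw [abs_le]; constructor <;> linarith

lemma abs_crossCoeff_le (m d : ℕ) : |crossCoeff m d| ≤ 1 := by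
  unfold crossCoeff
  generalize clamp _ = c
  have hc : 0 < 1 + c ^ 2 := by positivity
  have h1 : 1 / (1 + c ^ 2) ≤ 1 := by rw [div_le_one hc]; nlinarith
  have h2 : 0 < 1 / (1 + c ^ 2) := by positivity
  rw [abs_le]; constructor <;> linarith

lemma abs_diagCoeff_sub_le (n m j : ℕ) :
    |diagCoeff n m j - diagCoeff n m (j + 1)| ≤ 1 / m := by
  unfold diagCoeff
  rw [add_sub_add_left_eq_sub]
  refine (abs_div_one_add_sq_sub_le _ _).trans ((abs_clamp_sub_clamp_le _ _).trans ?_)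
  rw [← sub_div, abs_div]
  push_cast
  ring_nf
  simp

lemma abs_crossCoeff_sub_le (m d : ℕ) :
    |crossCoeff m d - crossCoeff m (d + 1)| ≤ 1 / m := by
  unfold crossCoeff
  rw [sub_sub_sub_cancel_right]
  refine (abs_one_div_one_add_sq_sub_le _ _).trans ((abs_clamp_sub_clamp_le _ _).trans ?_)
  rw [← sub_div, abs_div]
  push_cast
  ring_nf
  simp

lemma diagCoeff_of_add_le {n m j : ℕ} (hm : 0 < m) (h : j + m ≤ n) : diagCoeff n m j = 1 := by
  have hm' : (0 : ℝ) < m := by exact_mod_cast hm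
  have h' : (j : ℝ) + m ≤ n := by exact_mod_cast h
  rw [diagCoeff, clamp_of_one_le (by rw [le_div_iff₀ hm']; linarith)]
  norm_num

lemma diagCoeff_of_le {n m j : ℕ} (hm : 0 < m) (h : n + m ≤ j) : diagCoeff n m j = 0 := by
  have hm' : (0 : ℝ) < m := by exact_mod_cast hm
  have h' : (n : ℝ) + m ≤ j := by exact_mod_cast h
  rw [diagCoeff, clamp_of_le_neg_one (by rw [div_le_iff₀ hm']; linarith)]
  norm_num

lemma diagCoeff_self (n m : ℕ) : diagCoeff n m n = 1 / 2 := by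
  rw [diagCoeff, sub_self, zero_div, clamp_of_mem (by norm_num) (by norm_num)]
  norm_num

lemma crossCoeff_zero (m : ℕ) : crossCoeff m 0 = 1 / 2 := by
  rw [crossCoeff, Nat.cast_zero, zero_div, clamp_of_mem (by norm_num) (by norm_num)]
  norm_num

lemma crossCoeff_of_le {m d : ℕ} (hm : 0 < m) (h : m ≤ d) : crossCoeff m d = 0 := by
  have hm' : (0 : ℝ) < m := by exact_mod_cast hm
  have h' : (m : ℝ) ≤ d := by exact_mod_cast h
  rw [crossCoeff, clamp_of_one_le (by rw [le_div_iff₀ hm']; linarith)]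
  norm_num

/-- With $d=n-r<m$ and $c=d/m$, one has $\nu_r^{-1}\mu_r^2=\frac{(1+c)^2}{2(1+c^2)}=\frac12+\frac
c{1+c^2}$. Index $2n-r$ replaces $c$ by $-c$, and $\nu_r^{-1}\mu_r\mu_{2n-r}=\frac1{1+c^2}-\frac12$.
Clamping makes the same formulas valid for $r\le n-m$. The final correction accounts for the
different normalization of $p_0$. -/
lemma pi_mul_inv_nu_mul_q_cos {n m r : ℕ} (hm : 0 < m) (hmn : m < n) (hr : r < n) (s t : ℝ) :
    π * ((nu n m r)⁻¹ * (q n m r (cos s) * q n m r (cos t))) =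
      2 * (diagCoeff n m r * (cos (r * s) * cos (r * t)) +
        diagCoeff n m (2 * n - r) * (cos ((2 * n - r : ℕ) * s) * cos ((2 * n - r : ℕ) * t)) -
        crossCoeff m (n - r) * (cos (n * (s + t)) * cos ((n - r : ℕ) * (s - t)) +
          cos (n * (s - t)) * cos ((n - r : ℕ) * (s + t)))) - if r = 0 then 1 else 0 := by
  have hpi := pi_pos
  have hm' : (0 : ℝ) < m := by exact_mod_cast hm
  by_cases h : r + m ≤ n
  · rw [diagCoeff_of_add_le hm h, diagCoeff_of_le hm (by omega), crossCoeff_of_le hm (by omega)]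
    simp only [nu, q, h, if_true, chebP_cos]
    split_ifs with h0
    · have h1 : √(1 / π) * √(1 / π) = 1 / π := mul_self_sqrt (by positivity)
      subst h0
      simp only [Nat.cast_zero, zero_mul, cos_zero, mul_one]
      rw [h1]; field_simp; norm_num
    · have h1 : √(2 / π) * √(2 / π) = 2 / π := mul_self_sqrt (by positivity)
      rw [mul_mul_mul_comm, h1]
      field_simp; ring
  · obtain ⟨d, rfl⟩ : ∃ d, n = r + d := ⟨n - r, by omega⟩
    have hd : (d : ℝ) < m := by exact_mod_cast (by omega : d < m)
    have hd0 : (0 : ℝ) ≤ d := by positivity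
    have e1 : 2 * (r + d) - r = r + d + d := by omega
    have e2 : r + d - r = d := by omega
    have h1 : √(2 / π) * √(2 / π) = 2 / π := mul_self_sqrt (by positivity)
    have c1 : clamp ((((r + d : ℕ) : ℝ) - r) / m) = d / m := by
      rw [clamp_of_mem] <;> push_cast
      · congr 1; ring
      · rw [le_div_iff₀ hm']; linarith
      · rw [div_le_iff₀ hm']; linarith
    have c2 : clamp ((((r + d : ℕ) : ℝ) - ((r + d + d : ℕ) : ℝ)) / m) = -(d / m) := by
      rw [clamp_of_mem] <;> push_cast
      · ring
      · rw [le_div_iff₀ hm']; linarith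
      · rw [div_le_iff₀ hm']; linarith
    have c3 : clamp ((d : ℝ) / m) = d / m := by
      rw [clamp_of_mem]
      · rw [le_div_iff₀ hm']; linarith
      · rw [div_le_iff₀ hm']; linarith
    have hq : ∀ u, q (r + d) m r (cos u) = √(2 / π) *
        ((m + d) / (2 * m) * cos (r * u) - (m - d) / (2 * m) * cos ((r + d + d : ℕ) * u)) := by
      intro u
      simp only [q, mu, h, if_false, e1, chebP_cos]
      rw [if_pos (by omega), if_neg (by omega), if_neg (by omega), if_pos (by omega),
        if_neg (by omega)]
      push_cast
      ring
    -- The two mixed products, of frequencies $n-d$ and $n+d$, regroup so that the high frequency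
    -- $n$ appears only as a bounded factor.
    have hX : cos ((r + d : ℕ) * (s + t)) * cos (d * (s - t)) +
        cos ((r + d : ℕ) * (s - t)) * cos (d * (s + t)) =
        cos (r * s) * cos ((r + d + d : ℕ) * t) + cos ((r + d + d : ℕ) * s) * cos (r * t) := by
      have p1 : ∀ a b : ℝ, cos a * cos b = (cos (a - b) + cos (a + b)) / 2 := by
        intro a b; rw [cos_sub, cos_add]; ring
      simp only [p1]
      push_cast
      ring_nf
    rw [hq, hq, if_neg (by omega), e1, e2, hX]
    simp only [diagCoeff, crossCoeff, nu, h, if_false, c1, c2, c3]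
    generalize cos (r * s) = a1
    generalize cos (r * t) = a2
    generalize cos ((r + d + d : ℕ) * s) = b1
    generalize cos ((r + d + d : ℕ) * t) = b2
    have h3 : (0 : ℝ) < m ^ 2 + d ^ 2 := by positivity
    have h4 : ((r + d : ℕ) : ℝ) - r = d := by push_cast; ring
    rw [h4, mul_mul_mul_comm, h1]
    have h5 : (1 : ℝ) + (d / m) ^ 2 = (m ^ 2 + d ^ 2) / m ^ 2 := by field_simp
    rw [neg_sq, h5]
    field_simp
    ring

lemma cosSum_sub_add_cosSum_add (a : ℕ → ℝ) (N : ℕ) (s t : ℝ) :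
    (cosSum a N (s - t) + cosSum a N (s + t)) / 2 =
      2 * ∑ j ∈ range (N + 1), a j * (cos (j * s) * cos (j * t)) - a 0 := by
  have : ∑ j ∈ range (N + 1), a j * (cos (j * s) * cos (j * t)) =
      (∑ j ∈ range (N + 1), a j * cos (j * (s - t)) +
        ∑ j ∈ range (N + 1), a j * cos (j * (s + t))) / 2 := by
    rw [← sum_add_distrib, sum_div]
    refine sum_congr rfl fun j _ => ?_
    rw [mul_sub, mul_add, cos_sub, cos_add]; ring
  rw [this, cosSum, cosSum]; ring

/-- In the variables `x = cos s`, `y = cos t` the kernel splits into cosine sums in `s - t` and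
`s + t`. -/
theorem pi_mul_kernel_cos {n m : ℕ} (hm : 0 < m) (hmn : m < n) (s t : ℝ) :
    π * kernel n m (cos s) (cos t) =
      (cosSum (diagCoeff n m) (2 * n) (s - t) + cosSum (diagCoeff n m) (2 * n) (s + t)) / 2 -
      cos (n * (s + t)) * cosSum (crossCoeff m) n (s - t) -
      cos (n * (s - t)) * cosSum (crossCoeff m) n (s + t) := by
  set F : ℕ → ℝ := fun j => diagCoeff n m j * (cos (j * s) * cos (j * t)) with hF
  set X : ℕ → ℝ := fun d => crossCoeff m d * (cos (n * (s + t)) * cos (d * (s - t)) +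
          cos (n * (s - t)) * cos (d * (s + t))) with hX
  have h1 : π * kernel n m (cos s) (cos t) =
      2 * (∑ r ∈ range n, F r + ∑ r ∈ range n, F (2 * n - r) - ∑ r ∈ range n, X (n - r)) - 1 := by
    rw [kernel_eq_sum, mul_sum,
      sum_congr rfl fun r hr => pi_mul_inv_nu_mul_q_cos hm hmn (mem_range.1 hr) s t,
      sum_sub_distrib, ← mul_sum, sum_sub_distrib, sum_add_distrib]
    simp [hF, hX, show 0 < n by omega]
  have h2 : ∑ r ∈ range n, F (2 * n - r) = ∑ x ∈ range n, F (n + (x + 1)) := by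
    rw [← sum_range_reflect]
    refine sum_congr rfl fun r hr => ?_
    have := mem_range.1 hr
    congr 1; omega
  have h3 : ∑ r ∈ range n, X (n - r) = ∑ x ∈ range n, X (x + 1) := by
    rw [← sum_range_reflect]
    refine sum_congr rfl fun r hr => ?_
    have := mem_range.1 hr
    congr 1; omega
  have h4 : ∑ j ∈ range (2 * n + 1), F j =
      ∑ r ∈ range n, F r + ∑ x ∈ range n, F (n + (x + 1)) + F n := by
    rw [show 2 * n + 1 = n + (n + 1) by ring, sum_range_add, sum_range_succ', add_zero]
    ring
  have h5 : 2 * ∑ d ∈ range (n + 1), X d - X 0 =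
      cos (n * (s + t)) * cosSum (crossCoeff m) n (s - t) +
      cos (n * (s - t)) * cosSum (crossCoeff m) n (s + t) := by
    simp only [cosSum, hX, mul_sub, mul_sum, mul_add, sum_add_distrib, Nat.cast_zero, zero_mul,
      sub_zero, add_zero, cos_zero]
    have e : ∀ a b c : ℝ, 2 * (a * (b * c)) = b * (2 * (a * c)) := fun a b c => by ring
    simp only [e]
    ring
  rw [sum_range_succ'] at h5
  have h6 := cosSum_sub_add_cosSum_add (diagCoeff n m) (2 * n) s t
  rw [diagCoeff_of_add_le hm (by omega)] at h6
  -- The full cosine sums contain the extra indices $j=n$ and $d=0$. Their contributions cancel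
  -- since $2F(n)=X(0)$.
  have h7 : F n = cos (n * s) * cos (n * t) / 2 := by simp only [hF, diagCoeff_self]; ring
  have h8 : X 0 = cos (n * s) * cos (n * t) := by
    simp only [hX, crossCoeff_zero, mul_add, mul_sub, cos_add, cos_sub]
    simp; ring
  rw [h1, h2, h3]
  linarith

/-! ### Uniform bounds for the Lebesgue functions. -/

theorem integral_abs_kernel_cos_le {n m : ℕ} (hm : 0 < m) (hmn : m < n) (s : ℝ) :
    ∫ y, |kernel n m (cos s) y| ∂chebMeasure ≤ 10 + 8 * (2 * n / m) ^ 2 := by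
  have hpi := pi_pos
  rw [Polynomial.Chebyshev.integral_measureT_eq_integral_cos]
  set A := cosSum (diagCoeff n m) (2 * n) with hA
  set B := cosSum (crossCoeff m) n with hB
  have hAc : Continuous A := continuous_cosSum _ _
  have hBc : Continuous B := continuous_cosSum _ _
  have hKc := continuous_kernel n m
  have hA1 : ∫ u in -π..π, |A u| ≤ 4 * π + 4 * π * (2 * n / m) ^ 2 + π ^ 2 / 4 := by
    have := integral_abs_cosSum_le (a := diagCoeff n m) (N := 2 * n) (δ := 1 / m) (by omega)
      (diagCoeff_of_le hm (by omega)) (abs_diagCoeff_le n m) (abs_diagCoeff_sub_le n m)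
    push_cast at this
    rwa [mul_one_div] at this
  have hB1 : ∫ u in -π..π, |B u| ≤ 4 * π + 4 * π * (2 * n / m) ^ 2 + π ^ 2 / 4 := by
    have := integral_abs_cosSum_le (a := crossCoeff m) (N := n) (δ := 1 / m) (by omega)
      (crossCoeff_of_le hm (by omega)) (abs_crossCoeff_le m) (abs_crossCoeff_sub_le m)
    refine this.trans ?_
    rw [mul_one_div]
    gcongr
    have : (0 : ℝ) ≤ n := by positivity
    linarith
  have hA2 := integral_comp_sub_add_comp_add hAc.abs
    (fun u => congrArg abs (periodic_cosSum _ _ u)) s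
  have hB2 := integral_comp_sub_add_comp_add hBc.abs
    (fun u => congrArg abs (periodic_cosSum _ _ u)) s
  have i1 : IntervalIntegrable (fun t => |A (s - t)|) volume 0 π :=
    Continuous.intervalIntegrable (by fun_prop) _ _
  have i2 : IntervalIntegrable (fun t => |A (s + t)|) volume 0 π :=
    Continuous.intervalIntegrable (by fun_prop) _ _
  have i3 : IntervalIntegrable (fun t => |B (s - t)|) volume 0 π :=
    Continuous.intervalIntegrable (by fun_prop) _ _
  have i4 : IntervalIntegrable (fun t => |B (s + t)|) volume 0 π :=
    Continuous.intervalIntegrable (by fun_prop) _ _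
  have hK1 : Continuous fun t => |kernel n m (cos s) (cos t)| :=
    (hKc.comp (f := fun t => (cos s, cos t)) (by fun_prop)).abs
  have key : ∫ t in 0..π, |kernel n m (cos s) (cos t)| ≤
      ∫ t in 0..π, ((|A (s - t)| + |A (s + t)|) + (|B (s - t)| + |B (s + t)|)) / π := by
    refine intervalIntegral.integral_mono_on hpi.le (hK1.intervalIntegrable _ _)
      (((i1.add i2).add (i3.add i4)).div_const _) fun t _ => ?_
    have b0 : |kernel n m (cos s) (cos t)| * π = |π * kernel n m (cos s) (cos t)| := by
      rw [abs_mul, abs_of_pos hpi, mul_comm]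
    rw [le_div_iff₀ hpi, b0, pi_mul_kernel_cos hm hmn]
    have b1 : |cos (n * (s + t)) * B (s - t)| ≤ |B (s - t)| := by
      rw [abs_mul]; exact mul_le_of_le_one_left (abs_nonneg _) (abs_cos_le_one _)
    have b2 : |cos (n * (s - t)) * B (s + t)| ≤ |B (s + t)| := by
      rw [abs_mul]; exact mul_le_of_le_one_left (abs_nonneg _) (abs_cos_le_one _)
    have b3 : |(A (s - t) + A (s + t)) / 2| ≤ |A (s - t)| + |A (s + t)| := by
      rw [abs_div, abs_two]
      have := abs_add_le (A (s - t)) (A (s + t))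
      have := abs_nonneg (A (s - t))
      have := abs_nonneg (A (s + t))
      linarith
    have b4 := abs_sub ((A (s - t) + A (s + t)) / 2 - cos (n * (s + t)) * B (s - t))
      (cos (n * (s - t)) * B (s + t))
    have b5 := abs_sub ((A (s - t) + A (s + t)) / 2) (cos (n * (s + t)) * B (s - t))
    linarith
  refine key.trans ?_
  rw [intervalIntegral.integral_div, intervalIntegral.integral_add (i1.add i2) (i3.add i4),
    intervalIntegral.integral_add i1 i2, intervalIntegral.integral_add i3 i4, hA2, hB2,
    div_le_iff₀ hpi]
  -- The two $L^1$ bounds add up, after division by $\pi$, to $8+8(2n/m)^2+\pi/2$, and $\pi/2<2$.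
  have := pi_lt_four
  nlinarith

lemma abs_chebP_cos_le (r : ℕ) (t : ℝ) : |chebP r (cos t)| ≤ √(2 / π) := by
  rw [chebP_cos, abs_mul]
  have h : |if r = 0 then √(1 / π) else √(2 / π)| ≤ √(2 / π) := by
    have := pi_pos
    split_ifs
    · rw [abs_of_nonneg (sqrt_nonneg _)]
      exact sqrt_le_sqrt (by gcongr; norm_num)
    · rw [abs_of_nonneg (sqrt_nonneg _)]
  exact (mul_le_of_le_one_right (abs_nonneg _) (abs_cos_le_one _)).trans h

/-- Growth in $n$ is harmless: $m=0$ occurs only for $n<1/\theta$. -/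
theorem integral_abs_kernel_zero_cos_le (n : ℕ) (s : ℝ) :
    ∫ y, |kernel n 0 (cos s) y| ∂chebMeasure ≤ 2 * n := by
  have hpi := pi_pos
  rw [Polynomial.Chebyshev.integral_measureT_eq_integral_cos]
  have hK1 : Continuous fun t => |kernel n 0 (cos s) (cos t)| :=
    ((continuous_kernel n 0).comp (f := fun t => (cos s, cos t)) (by fun_prop)).abs
  have h : ∀ t, |kernel n 0 (cos s) (cos t)| ≤ n * (2 / π) := by
    intro t
    rw [kernel_eq_sum]
    refine (abs_sum_le_sum_abs _ _).trans ?_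
    calc _ ≤ ∑ r ∈ range n, 2 / π := by
          refine sum_le_sum fun r hr => ?_
          have hr' : r + 0 ≤ n := by have := mem_range.1 hr; omega
          simp only [nu, q, hr', if_true, inv_one, one_mul, abs_mul]
          rw [← mul_self_sqrt (show (0 : ℝ) ≤ 2 / π by positivity)]
          exact mul_le_mul (abs_chebP_cos_le r s) (abs_chebP_cos_le r t) (abs_nonneg _)
            (sqrt_nonneg _)
      _ = _ := by simp
  calc _ ≤ ∫ t in 0..π, (n * (2 / π) : ℝ) :=
        intervalIntegral.integral_mono_on hpi.le (hK1.intervalIntegrable _ _)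
          (by simp) fun t _ => h t
    _ = _ := by simp; field_simp

lemma lt_of_eq_floor {θ : ℝ} (hθ0 : 0 < θ) (hθ1 : θ < 1) {n m : ℕ} (hm0 : 0 < m)
    (hm : m = ⌊θ * (n : ℝ)⌋₊) : m < n := by
  have h1 : (m : ℝ) ≤ θ * n := by rw [hm]; exact Nat.floor_le (by positivity)
  have h2 : (0 : ℝ) < m := by exact_mod_cast hm0
  have : (m : ℝ) < n := by nlinarith
  exact_mod_cast this

/-- The Lebesgue functions of `S n m`, `m = ⌊θ n⌋`, are bounded uniformly in `n`. -/
theorem integral_abs_kernel_le {θ : ℝ} (hθ0 : 0 < θ) (hθ1 : θ < 1) {n m : ℕ} (hn : 0 < n)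
    (hm : m = ⌊θ * (n : ℝ)⌋₊) {x : ℝ} (hx : x ∈ Set.Icc (-1 : ℝ) 1) :
    ∫ y, |kernel n m x y| ∂chebMeasure ≤ 10 + 8 * (4 / θ) ^ 2 + 2 / θ := by
  have hn' : (0 : ℝ) < n := by exact_mod_cast hn
  rw [← cos_arccos hx.1 hx.2]
  rcases Nat.eq_zero_or_pos m with h0 | h0
  · rw [h0] at hm ⊢
    have h1 : θ * n < 1 := by
      have := Nat.lt_floor_add_one (θ * (n : ℝ))
      rw [← hm] at this; simpa using this
    have h2 : 2 * (n : ℝ) ≤ 2 / θ := by rw [le_div_iff₀ hθ0]; linarith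
    have := integral_abs_kernel_zero_cos_le n (arccos x)
    have h3 : (0 : ℝ) ≤ 8 * (4 / θ) ^ 2 := by positivity
    linarith
  · have hmn := lt_of_eq_floor hθ0 hθ1 h0 hm
    have hm' : (1 : ℝ) ≤ m := by exact_mod_cast h0
    have h2 : θ * n < m + 1 := by rw [hm]; exact Nat.lt_floor_add_one _
    -- Since $m\ge1$, $\theta n<m+1\le 2m$.
    have h3 : 2 * (n : ℝ) / m ≤ 4 / θ := by
      rw [div_le_div_iff₀ (by linarith) hθ0]; linarith
    refine (integral_abs_kernel_cos_le h0 hmn (arccos x)).trans ?_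
    have h4 : (0 : ℝ) < 2 / θ := by positivity
    have h5 : (2 * (n : ℝ) / m) ^ 2 ≤ (4 / θ) ^ 2 := pow_le_pow_left₀ (by positivity) h3 2
    linarith

/-! ### The spaces $L^p_w$. -/

instance : IsFiniteMeasure chebMeasure :=
  (integrable_const_iff_isFiniteMeasure one_ne_zero).1
    (Polynomial.Chebyshev.integrable_measureT (f := fun _ => 1) continuousOn_const)

lemma ae_mem_Icc : ∀ᵐ x ∂chebMeasure, x ∈ Set.Icc (-1 : ℝ) 1 := by
  rw [chebMeasure, Polynomial.Chebyshev.measureT]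
  filter_upwards [ae_restrict_mem measurableSet_Ioc] with x hx
  exact Set.Ioc_subset_Icc_self hx

lemma exists_bound_of_continuous {g : ℝ → ℝ} (hg : Continuous g) :
    ∃ M : ℝ, ∀ x ∈ Set.Icc (-1 : ℝ) 1, ‖g x‖ ≤ M :=
  isCompact_Icc.exists_bound_of_continuousOn hg.continuousOn

lemma integrable_mul_continuous {f g : ℝ → ℝ} (hf : Integrable f chebMeasure)
    (hg : Continuous g) : Integrable (fun x => f x * g x) chebMeasure := by
  obtain ⟨M, hM⟩ := exists_bound_of_continuous hg
  exact hf.mul_bdd hg.aestronglyMeasurable (ae_mem_Icc.mono hM)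

lemma memLpw_of_continuous {g : ℝ → ℝ} (hg : Continuous g) (p : ℝ≥0∞) : MemLpw p g := by
  obtain ⟨M, hM⟩ := exists_bound_of_continuous hg
  refine ⟨hg.aestronglyMeasurable, ?_⟩
  unfold wNorm
  split_ifs
  · refine lt_of_le_of_lt (iSup₂_le fun x hx => ?_) (ENNReal.ofReal_lt_top (r := M))
    rw [← ofReal_norm]
    exact ENNReal.ofReal_le_ofReal (hM x hx)
  · exact (MemLp.of_bound hg.aestronglyMeasurable M (ae_mem_Icc.mono hM)).2

lemma MemLpw.integrable {p : ℝ≥0∞} (hp : 1 ≤ p) {f : ℝ → ℝ} (hf : MemLpw p f) :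
    Integrable f chebMeasure := by
  obtain ⟨hm, hlt⟩ := hf
  unfold wNorm at hlt
  split_ifs at hlt with h
  · refine Integrable.of_bound hm (⨆ x ∈ Set.Icc (-1 : ℝ) 1, ‖f x‖ₑ).toReal
      (ae_mem_Icc.mono fun x hx => ?_)
    rw [← toReal_enorm]
    exact ENNReal.toReal_mono hlt.ne (le_iSup₂ (f := fun x _ => ‖f x‖ₑ) x hx)
  · exact MemLp.integrable hp ⟨hm, hlt⟩

lemma wNorm_sub_le {p : ℝ≥0∞} (hp : 1 ≤ p) {f g : ℝ → ℝ}
    (hf : AEStronglyMeasurable f chebMeasure) (hg : AEStronglyMeasurable g chebMeasure) :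
    wNorm p (fun x => f x - g x) ≤ wNorm p f + wNorm p g := by
  unfold wNorm
  split_ifs
  · refine iSup₂_le fun x hx => (enorm_sub_le).trans (add_le_add ?_ ?_)
    · exact le_iSup₂ (f := fun x _ => ‖f x‖ₑ) x hx
    · exact le_iSup₂ (f := fun x _ => ‖g x‖ₑ) x hx
  · exact eLpNorm_sub_le hf hg hp

lemma wNorm_sub_comm (p : ℝ≥0∞) (f g : ℝ → ℝ) :
    wNorm p (fun x => f x - g x) = wNorm p (fun x => g x - f x) := by
  unfold wNorm
  split_ifs
  · simp only [enorm_sub_rev]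
  · exact eLpNorm_sub_comm f g p _

lemma MemLpw.sub {p : ℝ≥0∞} (hp : 1 ≤ p) {f g : ℝ → ℝ} (hf : MemLpw p f) (hg : MemLpw p g) :
    MemLpw p (fun x => f x - g x) :=
  ⟨hf.1.sub hg.1, (wNorm_sub_le hp hf.1 hg.1).trans_lt (ENNReal.add_lt_top.2 ⟨hf.2, hg.2⟩)⟩

/-! ### Boundedness of the projection on $L^p_w$. -/

/-- **Schur test**, for a kernel on the same space in both variables. -/
theorem lintegral_rpow_lintegral_mul_le {α : Type*} [MeasurableSpace α] {μ : Measure α} [SFinite μ]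
    {k : α → α → ℝ≥0∞} (hk : Measurable (Function.uncurry k)) {C : ℝ≥0∞}
    (h1 : ∀ᵐ x ∂μ, ∫⁻ y, k x y ∂μ ≤ C) (h2 : ∀ᵐ y ∂μ, ∫⁻ x, k x y ∂μ ≤ C)
    {r : ℝ} (hr : 1 ≤ r) {g : α → ℝ≥0∞} (hg : AEMeasurable g μ) :
    ∫⁻ x, (∫⁻ y, k x y * g y ∂μ) ^ r ∂μ ≤ C ^ r * ∫⁻ y, g y ^ r ∂μ := by
  have hr0 : 0 < r := by linarith
  have hinv : r⁻¹ ≤ 1 := inv_le_one_of_one_le₀ hr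
  have hinv0 : 0 ≤ r⁻¹ := by positivity
  have hrm : 0 ≤ r - 1 := by linarith
  have hkx : ∀ x, Measurable (k x) := fun x => hk.of_uncurry_left
  have hky : ∀ y, Measurable fun x => k x y := fun y => hk.of_uncurry_right
  have hgr : AEMeasurable (fun y => g y ^ r) μ := hg.pow_const r
  have step : ∀ᵐ x ∂μ, (∫⁻ y, k x y * g y ∂μ) ^ r ≤ C ^ (r - 1) * ∫⁻ y, k x y * g y ^ r ∂μ := by
    filter_upwards [h1] with x hx
    -- Splitting for Hölder with weights $1-1/r$ and $1/r$. The case $r=1$ is included.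
    have e : ∀ y, k x y * g y = k x y ^ (1 - r⁻¹) * (k x y * g y ^ r) ^ r⁻¹ := by
      intro y
      rw [ENNReal.mul_rpow_of_nonneg _ _ hinv0, ← ENNReal.rpow_mul, mul_inv_cancel₀ hr0.ne',
        ENNReal.rpow_one, ← mul_assoc, ← ENNReal.rpow_add_of_nonneg _ _ (by linarith) hinv0,
        sub_add_cancel, ENNReal.rpow_one]
    calc (∫⁻ y, k x y * g y ∂μ) ^ r
        ≤ ((∫⁻ y, k x y ∂μ) ^ (1 - r⁻¹) * (∫⁻ y, k x y * g y ^ r ∂μ) ^ r⁻¹) ^ r := by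
          refine ENNReal.rpow_le_rpow ?_ hr0.le
          simp_rw [e]
          exact ENNReal.lintegral_mul_norm_pow_le (hkx x).aemeasurable
            ((hkx x).aemeasurable.mul hgr) (by linarith) hinv0 (by ring)
      _ = (∫⁻ y, k x y ∂μ) ^ (r - 1) * ∫⁻ y, k x y * g y ^ r ∂μ := by
          rw [ENNReal.mul_rpow_of_nonneg _ _ hr0.le, ← ENNReal.rpow_mul, ← ENNReal.rpow_mul,
            inv_mul_cancel₀ hr0.ne', ENNReal.rpow_one, sub_mul, one_mul, inv_mul_cancel₀ hr0.ne']
      _ ≤ _ := by gcongr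
  calc ∫⁻ x, (∫⁻ y, k x y * g y ∂μ) ^ r ∂μ
      ≤ ∫⁻ x, C ^ (r - 1) * ∫⁻ y, k x y * g y ^ r ∂μ ∂μ := lintegral_mono_ae step
    _ = C ^ (r - 1) * ∫⁻ y, ∫⁻ x, k x y * g y ^ r ∂μ ∂μ := by
        have hm : AEMeasurable (Function.uncurry fun x y => k x y * g y ^ r) (μ.prod μ) :=
          hk.aemeasurable.mul (hgr.comp_snd)
        have hm' : AEMeasurable (fun x => ∫⁻ y, k x y * g y ^ r ∂μ) μ := hm.lintegral_prod_right'
        rw [lintegral_const_mul'' _ hm', lintegral_lintegral_swap hm]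
    _ ≤ C ^ (r - 1) * ∫⁻ y, C * g y ^ r ∂μ := by
        gcongr 1
        refine lintegral_mono_ae ?_
        filter_upwards [h2] with y hy
        rw [lintegral_mul_const _ (hky y)]
        gcongr
    _ = _ := by
        rw [lintegral_const_mul'' _ hgr, ← mul_assoc]
        congr 1
        conv_rhs => rw [show r = (r - 1) + 1 by ring,
          ENNReal.rpow_add_of_nonneg _ _ hrm zero_le_one, ENNReal.rpow_one]

lemma continuous_S (n m : ℕ) (f : ℝ → ℝ) : Continuous (S n m f) := by
  have := continuous_scaling
  unfold S
  fun_prop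

lemma S_eq_integral (n m : ℕ) {f : ℝ → ℝ} (hf : Integrable f chebMeasure) (x : ℝ) :
    S n m f x = ∫ y, kernel n m x y * f y ∂chebMeasure := by
  have h : ∀ y, kernel n m x y * f y =
      ∑ k ∈ Icc 1 n, f y * scaling n m k y * scaling n m k x := by
    intro y
    rw [kernel, sum_mul]
    exact sum_congr rfl fun k _ => by ring
  simp_rw [h]
  rw [integral_finsetSum _ fun k _ =>
    (integrable_mul_continuous hf (continuous_scaling n m k)).mul_const _]
  simp_rw [integral_mul_const]
  rfl

lemma S_sub (n m : ℕ) {f g : ℝ → ℝ} (hf : Integrable f chebMeasure)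
    (hg : Integrable g chebMeasure) (x : ℝ) :
    S n m (fun y => f y - g y) x = S n m f x - S n m g x := by
  rw [S, S, S, ← sum_sub_distrib]
  refine sum_congr rfl fun k _ => ?_
  have hc := continuous_scaling n m k
  simp only [wInner, sub_mul]
  rw [integral_sub (integrable_mul_continuous hf hc) (integrable_mul_continuous hg hc), sub_mul]

lemma S_add (n m : ℕ) {f g : ℝ → ℝ} (hf : Integrable f chebMeasure)
    (hg : Integrable g chebMeasure) (x : ℝ) :
    S n m (fun y => f y + g y) x = S n m f x + S n m g x := by
  rw [S, S, S, ← sum_add_distrib]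
  refine sum_congr rfl fun k _ => ?_
  have hc := continuous_scaling n m k
  simp only [wInner, add_mul]
  rw [integral_add (integrable_mul_continuous hf hc) (integrable_mul_continuous hg hc), add_mul]

lemma S_const_mul (n m : ℕ) (c : ℝ) (f : ℝ → ℝ) (x : ℝ) :
    S n m (fun y => c * f y) x = c * S n m f x := by
  rw [S, S, mul_sum]
  refine sum_congr rfl fun k _ => ?_
  simp only [wInner, mul_assoc]
  rw [integral_const_mul, mul_assoc]

lemma enorm_S_le (n m : ℕ) {f : ℝ → ℝ} (hf : Integrable f chebMeasure) (x : ℝ) :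
    ‖S n m f x‖ₑ ≤ ∫⁻ y, ‖kernel n m x y‖ₑ * ‖f y‖ₑ ∂chebMeasure := by
  rw [S_eq_integral n m hf]
  refine (enorm_integral_le_lintegral_enorm _).trans_eq ?_
  simp_rw [enorm_mul]

/-- A uniform bound of the Lebesgue functions bounds `S n m` on every `L^p_w`. -/
theorem wNorm_S_le {n m : ℕ} {C : ℝ≥0∞}
    (hC : ∀ x ∈ Set.Icc (-1 : ℝ) 1, ∫⁻ y, ‖kernel n m x y‖ₑ ∂chebMeasure ≤ C)
    {p : ℝ≥0∞} (hp : 1 ≤ p) {f : ℝ → ℝ} (hf : MemLpw p f) :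
    wNorm p (S n m f) ≤ C * wNorm p f := by
  have hfi := hf.integrable hp
  have hk : Measurable (Function.uncurry fun x y => ‖kernel n m x y‖ₑ) :=
    (continuous_kernel n m).measurable.enorm
  unfold wNorm
  split_ifs with h
  · refine iSup₂_le fun x hx => (enorm_S_le n m hfi x).trans ?_
    calc _ ≤ ∫⁻ y, ‖kernel n m x y‖ₑ * (⨆ x ∈ Set.Icc (-1 : ℝ) 1, ‖f x‖ₑ) ∂chebMeasure := by
          refine lintegral_mono_ae (ae_mem_Icc.mono fun y hy => ?_)
          gcongr
          exact le_iSup₂ (f := fun x _ => ‖f x‖ₑ) y hy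
      _ = (∫⁻ y, ‖kernel n m x y‖ₑ ∂chebMeasure) * (⨆ x ∈ Set.Icc (-1 : ℝ) 1, ‖f x‖ₑ) :=
          lintegral_mul_const _ hk.of_uncurry_left
      _ ≤ _ := by gcongr; exact hC x hx
  · have hp0 : p ≠ 0 := (zero_lt_one.trans_le hp).ne'
    have hr : 1 ≤ p.toReal := by
      have := ENNReal.toReal_mono h hp
      simpa using this
    have hr0 : 0 < p.toReal := by linarith
    rw [eLpNorm_eq_lintegral_rpow_enorm_toReal hp0 h, eLpNorm_eq_lintegral_rpow_enorm_toReal hp0 h]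
    have h1 : ∀ᵐ x ∂chebMeasure, ∫⁻ y, ‖kernel n m x y‖ₑ ∂chebMeasure ≤ C :=
      ae_mem_Icc.mono hC
    -- Symmetry of the kernel makes the column bound the same as the row bound.
    have h2 : ∀ᵐ y ∂chebMeasure, ∫⁻ x, ‖kernel n m x y‖ₑ ∂chebMeasure ≤ C :=
      ae_mem_Icc.mono fun y hy => by simpa only [kernel_comm n m _ y] using hC y hy
    calc _ ≤ (C ^ p.toReal * ∫⁻ y, ‖f y‖ₑ ^ p.toReal ∂chebMeasure) ^ (1 / p.toReal) := by
          refine ENNReal.rpow_le_rpow ((lintegral_mono fun x => ?_).trans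
            (lintegral_rpow_lintegral_mul_le hk h1 h2 hr hf.1.enorm)) (by positivity)
          exact ENNReal.rpow_le_rpow (enorm_S_le n m hfi x) hr0.le
      _ = _ := by
          rw [ENNReal.mul_rpow_of_nonneg _ _ (by positivity), ← ENNReal.rpow_mul,
            mul_one_div_cancel hr0.ne', ENNReal.rpow_one]

theorem lintegral_enorm_kernel_le {θ : ℝ} (hθ0 : 0 < θ) (hθ1 : θ < 1) {n m : ℕ} (hn : 0 < n)
    (hm : m = ⌊θ * (n : ℝ)⌋₊) {x : ℝ} (hx : x ∈ Set.Icc (-1 : ℝ) 1) :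
    ∫⁻ y, ‖kernel n m x y‖ₑ ∂chebMeasure ≤ ENNReal.ofReal (10 + 8 * (4 / θ) ^ 2 + 2 / θ) := by
  have hc : Continuous (kernel n m x) :=
    (continuous_kernel n m).comp (f := fun y => (x, y)) (by fun_prop)
  rw [← ofReal_integral_norm_eq_lintegral_enorm
    (Polynomial.Chebyshev.integrable_measureT hc.continuousOn)]
  exact ENNReal.ofReal_le_ofReal (integral_abs_kernel_le hθ0 hθ1 hn hm hx)

/-! ### Reproduction of polynomials and range of the projection. -/

lemma integrable_of_continuous {g : ℝ → ℝ} (hg : Continuous g) : Integrable g chebMeasure :=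
  Polynomial.Chebyshev.integrable_measureT hg.continuousOn

/-- `S n m` reproduces the Chebyshev polynomials of degree at most `n - m`. -/
lemma S_chebP {n m j : ℕ} (hm : 0 < m) (hj : j + m ≤ n) (x : ℝ) :
    S n m (chebP j) x = chebP j x := by
  have hcj := continuous_chebP j
  have hcq := continuous_q n m
  have hq : ∀ r ∈ range n, ∫ y, q n m r y * chebP j y ∂chebMeasure = if r = j then 1 else 0 := by
    intro r hr
    have hr' := mem_range.1 hr
    by_cases h : r + m ≤ n
    · simp only [q, h, if_true, integral_chebP_mul_chebP]
    -- Both $r$ and $2n-r$ exceed $n-m\ge j$, so this $q_r$ is orthogonal to $p_j$.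
    · simp only [q, h, if_false, sub_mul, mul_assoc]
      have c1 := continuous_chebP r
      have c2 := continuous_chebP (2 * n - r)
      rw [integral_sub (integrable_of_continuous (by fun_prop))
        (integrable_of_continuous (by fun_prop)), integral_const_mul, integral_const_mul,
        integral_chebP_mul_chebP, integral_chebP_mul_chebP, if_neg (by omega), if_neg (by omega),
        mul_zero, mul_zero, sub_zero]
  rw [S_eq_integral n m (integrable_of_continuous hcj)]
  have h : ∀ y, kernel n m x y * chebP j y =
      ∑ r ∈ range n, (nu n m r)⁻¹ * q n m r x * (q n m r y * chebP j y) := by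
    intro y
    rw [kernel_eq_sum, sum_mul]
    exact sum_congr rfl fun r _ => by ring
  simp_rw [h]
  rw [integral_finsetSum _ fun r _ => integrable_of_continuous (by have := hcq r; fun_prop)]
  simp_rw [integral_const_mul]
  rw [sum_congr rfl fun r hr => by rw [hq r hr]]
  have hjn : j < n := by omega
  simp [nu, q, hj, hjn]

/-- `S n m` reproduces the polynomials of degree at most `n - m`. -/
theorem S_polynomial {n m : ℕ} (hm : 0 < m) (hmn : m < n) {P : Polynomial ℝ}
    (hP : P ∈ Polynomial.degreeLE ℝ ((n - m : ℕ) : WithBot ℕ)) (x : ℝ) :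
    S n m (fun y => P.eval y) x = P.eval x := by
  have hpi := pi_pos
  have hspan := (Polynomial.Chebyshev.chebyshevTsequence ℝ).span_degreeLE (m := n - m)
    fun i _ => (Polynomial.leadingCoeff_ne_zero.2
      ((Polynomial.Chebyshev.chebyshevTsequence ℝ).ne_zero i)).isUnit
  rw [← hspan] at hP
  induction hP using Submodule.span_induction with
  | mem P hP =>
    obtain ⟨j, hj, rfl⟩ := hP
    have hj' : j ≤ n - m := hj
    set c : ℝ := if j = 0 then √(1 / π) else √(2 / π) with hc
    have hc0 : c ≠ 0 := by rw [hc]; split_ifs <;> positivity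
    have h : ∀ y, (Polynomial.Chebyshev.chebyshevTsequence ℝ j).eval y = c⁻¹ * chebP j y := by
      intro y
      rw [chebP, ← hc, inv_mul_cancel_left₀ hc0]
      rfl
    simp only [h]
    rw [S_const_mul, S_chebP hm (by omega)]
  | zero => simp [S, wInner]
  | add P Q _ _ hP hQ =>
    simp only [Polynomial.eval_add]
    rw [S_add n m (integrable_of_continuous P.continuous)
      (integrable_of_continuous Q.continuous), hP, hQ]
  | smul c P _ hP =>
    simp only [Polynomial.eval_smul, smul_eq_mul]
    rw [S_const_mul, hP]

/-- The range of `S n m` consists of polynomials of degree at most `n + m - 1`. -/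
theorem exists_polynomial_S_eq {n m : ℕ} (hm : 0 < m) (f : ℝ → ℝ) :
    ∃ P ∈ Polynomial.degreeLE ℝ ((n + m - 1 : ℕ) : WithBot ℕ), ∀ x, S n m f x = P.eval x := by
  set V := Polynomial.degreeLE ℝ ((n + m - 1 : ℕ) : WithBot ℕ) with hV
  have hcheb : ∀ {r : ℕ}, r ≤ n + m - 1 → chebPoly r ∈ V := fun {r} hr =>
    Polynomial.mem_degreeLE.2 ((degree_chebPoly_le r).trans (by exact_mod_cast hr))
  have hq : ∀ r : ℕ, ∃ Q ∈ V, r < n → ∀ x, q n m r x = Q.eval x := by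
    intro r
    by_cases hr : r < n
    swap
    · exact ⟨0, V.zero_mem, fun h => absurd h hr⟩
    by_cases h : r + m ≤ n
    · exact ⟨chebPoly r, hcheb (by omega), fun _ x => by simp only [q, h, if_true, chebP_eq_eval]⟩
    -- Here $r>n-m$, hence $2n-r\le n+m-1$.
    · refine ⟨mu n m r • chebPoly r - mu n m (2 * n - r) • chebPoly (2 * n - r),
        V.sub_mem (V.smul_mem _ (hcheb (by omega))) (V.smul_mem _ (hcheb (by omega))),
        fun _ x => ?_⟩
      simp only [q, h, if_false, chebP_eq_eval, Polynomial.eval_sub, Polynomial.eval_smul,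
        smul_eq_mul]
  choose Q hQV hQ using hq
  refine ⟨∑ k ∈ Icc 1 n, wInner f (scaling n m k) • ∑ r ∈ range n, tau n m r k • Q r,
    V.sum_mem fun k _ => V.smul_mem _ (V.sum_mem fun r _ => V.smul_mem _ (hQV r)), fun x => ?_⟩
  simp only [S, Polynomial.eval_finsetSum, Polynomial.eval_smul, smul_eq_mul]
  refine sum_congr rfl fun k _ => ?_
  congr 1
  exact sum_congr rfl fun r hr => by rw [hQ r (mem_range.1 hr)]

end VPScaling

/-! ### The main theorem. -/

theorem corollary3p1 (θ : ℝ) (hθ0 : 0 < θ) (hθ1 : θ < 1) :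
    ∃ C : ℝ≥0, 0 < C ∧
      (∀ p : ℝ≥0∞, 1 ≤ p → ∀ n m : ℕ, 0 < n → m = ⌊θ * (n : ℝ)⌋₊ →
        ∀ f : ℝ → ℝ, VPScaling.MemLpw p f →
          VPScaling.MemLpw p (VPScaling.S n m f) ∧
          VPScaling.wNorm p (VPScaling.S n m f) ≤ (C : ℝ≥0∞) * VPScaling.wNorm p f) ∧
      (∀ p : ℝ≥0∞, 1 ≤ p → ∀ n m : ℕ, 0 < m → m = ⌊θ * (n : ℝ)⌋₊ →
        ∀ f : ℝ → ℝ, VPScaling.MemLpw p f →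
          VPScaling.bestError (n + m - 1) f p ≤
            VPScaling.wNorm p (fun x => VPScaling.S n m f x - f x) ∧
          VPScaling.wNorm p (fun x => VPScaling.S n m f x - f x) ≤
            (C : ℝ≥0∞) * VPScaling.bestError (n - m) f p) := by
  open VPScaling in
  set B : ℝ≥0 := (10 + 8 * (4 / θ) ^ 2 + 2 / θ).toNNReal with hB
  have bound : ∀ p : ℝ≥0∞, 1 ≤ p → ∀ n m : ℕ, 0 < n → m = ⌊θ * (n : ℝ)⌋₊ →
      ∀ f : ℝ → ℝ, MemLpw p f → wNorm p (S n m f) ≤ (B : ℝ≥0∞) * wNorm p f :=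
    fun p hp n m hn hm f hf =>
      wNorm_S_le (fun x hx => lintegral_enorm_kernel_le hθ0 hθ1 hn hm hx) hp hf
  -- The extra 1 pays for the identity in $S-I$.
  refine ⟨B + 1, by positivity, fun p hp n m hn hm f hf => ⟨?_, ?_⟩,
    fun p hp n m hm0 hm f hf => ⟨?_, ?_⟩⟩
  · exact memLpw_of_continuous (continuous_S n m f) p
  · refine (bound p hp n m hn hm f hf).trans ?_
    gcongr
    simp
  · obtain ⟨P, hP, hSP⟩ := exists_polynomial_S_eq (n := n) hm0 f
    simp only [hSP]
    rw [wNorm_sub_comm]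
    exact iInf₂_le P hP
  · have hmn := lt_of_eq_floor hθ0 hθ1 hm0 hm
    rw [bestError, ENNReal.mul_iInf_of_ne (by simp) (by simp)]
    refine le_iInf fun P => ?_
    rw [ENNReal.mul_iInf_of_ne (by simp) (by simp)]
    refine le_iInf fun hP => ?_
    have hPL : MemLpw p fun x => P.eval x := memLpw_of_continuous P.continuous p
    have hfP := hf.sub hp hPL
    -- Lebesgue's argument: $S-I$ annihilates $P$, so $f$ may be replaced by $f-P$ before applying
    -- the norm bound.
    have h1 : (fun x => S n m f x - f x) =
        fun x => S n m (fun y => f y - P.eval y) x - (f x - P.eval x) := by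
      funext x
      rw [S_sub n m (hf.integrable hp) (hPL.integrable hp), S_polynomial hm0 hmn hP]
      ring
    rw [h1]
    refine (wNorm_sub_le hp (continuous_S n m _).aestronglyMeasurable hfP.1).trans ?_
    rw [ENNReal.coe_add, ENNReal.coe_one, add_mul, one_mul]
    gcongr
    exact bound p hp n m (by omega) hm _ hfP
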